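/- Let $n\ge 2$ and $k\ge 1$ be integers and let $F$ be a probability distribution on $[0,1]$. There are $n$ Bernoulli arms whose means $P^{(1)},\dots,P^{(n)}$ are independent random variables with distribution $F$. Conditionally on the means, all observations of all arms are independent, and each observation of an arm with mean $p$ is a success with probability $p$ and a failure with probability $1-p$. Give the number $0$ to an arm with the largest mean (ties, if any, being broken without looking at the observations), and number the other arms $1,\dots,n-1$ uniformly at random, independently of the observations given the means. In each round $t=1,2,\dots$ one observation is taken from every arm; let $s_i(t)$ be the number of successes among the first $t$ observations of the arm numbered $i$, with $s_i(0)=0$. For $i=1,\dots,n-1$ let $B_i$ be the event that the difference $s_0(t)-s_i(t)$ hits the value $k$ before it hits $-k$, i.e. that the best arm wins its gambler's ruin game against arm $i$, and let $B=B_1\cap B_2\cap\cdots\cap B_{n-1}$. Then $$\mathbb P(B)\ \ge\ \bigl(\mathbb P(B_1)\bigr)^{n-1}.$$ -/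

import Mathlib

open MeasureTheory ProbabilityTheory

namespace BernoulliArms

variable {Ω : Type*} {n : ℕ}

/-- `successes X i t ω` is the number `s_i(t)` of successes among the first `t` observations of
arm `i`; `X i j` tells whether the `(j+1)`-st observation of arm `i` is a success. -/
def successes (X : Fin n → ℕ → Ω → Bool) (i : Fin n) (t : ℕ) (ω : Ω) : ℕ :=
  ((Finset.range t).filter (fun j => X i j ω = true)).card

/-- Arm `a` wins its gambler's ruin game against arm `b`: the difference `s_a(t) - s_b(t)` hits the
value `k` before it hits `-k`. -/
def Beats (X : Fin n → ℕ → Ω → Bool) (k : ℕ) (a b : Fin n) (ω : Ω) : Prop :=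
  ∃ t : ℕ, (successes X a t ω : ℤ) - successes X b t ω = k ∧
    ∀ r < t, (successes X a r ω : ℤ) - successes X b r ω ≠ -k

/-- The event `B_i` that the arm numbered `0` beats the arm numbered `i`, where `σ ω l` is the
arm that carries the number `l`. -/
def bestBeats (X : Fin n → ℕ → Ω → Bool) (k : ℕ) (σ : Ω → Equiv.Perm (Fin n)) (i : Fin n) :
    Set Ω :=
  {ω | Beats X k (σ ω ⟨0, i.pos⟩) (σ ω i) ω}

/-- The arm means `P_1, …, P_n` are independent random variables with common distribution `F`. -/
structure HasPrior [MeasurableSpace Ω] (μ : Measure Ω) (F : Measure ℝ) (P : Fin n → Ω → ℝ) :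
    Prop where
  measurable : ∀ i, Measurable (P i)
  indep : iIndepFun P μ
  law : ∀ i, μ.map (P i) = F

/-- The arm with the largest mean gets the number `0`, and the others are numbered
`1, …, n - 1` at random: given the means and the arm numbered `0`, all numberings of the
other arms are equally likely. -/
structure IsRandomNumbering [MeasurableSpace Ω] [NeZero n] (μ : Measure Ω) (P : Fin n → Ω → ℝ)
    (σ : Ω → Equiv.Perm (Fin n)) : Prop where
  measurable : ∀ s, MeasurableSet {ω | σ ω = s}
  best : ∀ᵐ ω ∂μ, ∀ j, P j ω ≤ P (σ ω 0) ω
  uniform : ∀ s s' : Equiv.Perm (Fin n), s 0 = s' 0 → ∀ A : Set (Fin n → ℝ), MeasurableSet A →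
    μ {ω | σ ω = s ∧ (fun i => P i ω) ∈ A} = μ {ω | σ ω = s' ∧ (fun i => P i ω) ∈ A}

/-- The σ-algebra generated by the arm means and by the numbering. -/
abbrev sigmaMeans (P : Fin n → Ω → ℝ) (σ : Ω → Equiv.Perm (Fin n)) : MeasurableSpace Ω :=
  (⨆ i, MeasurableSpace.comap (P i) inferInstance) ⊔ MeasurableSpace.comap σ ⊤

/-- Given the means (and the numbering, which is made without looking at the rewards), the
observations are independent, those of arm `i` being Bernoulli with mean `P i`; this is
expressed through the conditional probabilities of all finite-dimensional events. -/
structure HasBernoulliRewards [MeasurableSpace Ω] (μ : Measure Ω) (P : Fin n → Ω → ℝ)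
    (σ : Ω → Equiv.Perm (Fin n)) (X : Fin n → ℕ → Ω → Bool) : Prop where
  measurable : ∀ i j, Measurable (X i j)
  cond : ∀ (S : Finset (Fin n × ℕ)) (x : Fin n × ℕ → Bool),
    μ[Set.indicator {ω | ∀ q ∈ S, X q.1 q.2 ω = x q} (fun _ => (1 : ℝ)) | sigmaMeans P σ]
      =ᵐ[μ] fun ω => ∏ q ∈ S, if x q = true then P q.1 ω else 1 - P q.1 ω

end BernoulliArms

namespace BernoulliArms

open scoped ENNReal

/-! Given the mean `a` of the best arm and its observations `x`, the other arms are i.i.d. and play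
the same game against `x`; positive correlation is then Jensen's inequality for a power. Atoms of
`F` spoil the conditional independence through ties, and an auxiliary uniform tie variable `u`
restores it (`lintegral_prod_tieWeight`): the means listed by number have density `n * argmaxProb`
(`lintegral_numbered_means`), and for fixed `u` the tie weight is a product over the other arms
(`measure_paths_eq`).

For games decided within `T` rounds, write `h` for the mass of losing arms that are beaten and `W`
for the mass of all losing arms. With `n = m + 2`, the quantities `P(B)`, `P(B_1)` and `1` are `n`
times the integrals of `h ^ (m+1)`, `h * W ^ m` and `W ^ (m+1)` against one common measure. Hölder's
inequality, obtained from a weighted AM-GM inequality, concludes (`pow_measure_path_le`). Letting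
`T` tend to infinity gives the theorem. -/

/-! ### Weighted AM-GM inequality -/

lemma mul_mul_pow_le_pow_add_real {a b : ℝ} (ha : 0 ≤ a) (hb : 0 ≤ b) (m : ℕ) :
    (m + 1) * (a * b ^ m) ≤ a ^ (m + 1) + m * b ^ (m + 1) := by
  induction m with
  | zero => simp
  | succ m ih =>
    have h1 := mul_le_mul_of_nonneg_left ih ha
    -- The goal is exactly the sum of `a` times the induction hypothesis and this square term.
    have h2 : 0 ≤ ((m : ℝ) + 1) * b ^ m * (a - b) ^ 2 := by positivity
    push_cast
    ring_nf at h1 h2 ⊢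
    linarith

/-- A weighted arithmetic-geometric mean inequality. -/
lemma mul_mul_pow_le_pow_add (a b : ℝ≥0∞) (m : ℕ) :
    (m + 1) * (a * b ^ m) ≤ a ^ (m + 1) + m * b ^ (m + 1) := by
  rcases Nat.eq_zero_or_pos m with rfl | hm
  · simp
  rcases eq_or_ne a ⊤ with rfl | ha
  · simp
  rcases eq_or_ne b ⊤ with rfl | hb
  · simp [ENNReal.mul_top, hm.ne']
  lift a to NNReal using ha
  lift b to NNReal using hb
  exact_mod_cast mul_mul_pow_le_pow_add_real a.2 b.2 m

/-! ### Uniform tie-breaking as an average of product weights -/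

/-- The weight `1` below `a`, `u` at `a`, and `0` above `a`. -/
noncomputable def tieWeight (u a q : ℝ) : ℝ≥0∞ :=
  if q < a then 1 else if q = a then ENNReal.ofReal u else 0

lemma measurable_tieWeight : Measurable fun z : ℝ × ℝ × ℝ => tieWeight z.1 z.2.1 z.2.2 := by
  unfold tieWeight
  refine Measurable.ite (measurableSet_lt (by fun_prop) (by fun_prop)) (by fun_prop) ?_
  exact Measurable.ite (measurableSet_eq_fun (by fun_prop) (by fun_prop)) (by fun_prop)
    (by fun_prop)

open scoped Classical in
/-- The probability that index `0` is chosen when a maximal coordinate of `p` is chosen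
uniformly at random. -/
noncomputable def argmaxProb {m : ℕ} (p : Fin (m + 1) → ℝ) : ℝ≥0∞ :=
  if ∀ j, p j ≤ p 0 then (Finset.univ.filter fun j => p j = p 0).card⁻¹ else 0

lemma lintegral_ofReal_pow (N : ℕ) :
    ∫⁻ u in Set.Icc (0 : ℝ) 1, ENNReal.ofReal u ^ N = ((N : ℝ≥0∞) + 1)⁻¹ := by
  have h1 : ∫⁻ u in Set.Icc (0 : ℝ) 1, ENNReal.ofReal u ^ N
      = ∫⁻ u in Set.Icc (0 : ℝ) 1, ENNReal.ofReal (u ^ N) :=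
    setLIntegral_congr_fun measurableSet_Icc fun u hu => (ENNReal.ofReal_pow hu.1 N).symm
  rw [h1, ← ofReal_integral_eq_lintegral_ofReal]
  · rw [integral_Icc_eq_integral_Ioc, ← intervalIntegral.integral_of_le zero_le_one, integral_pow]
    simp only [one_pow, ne_eq, Nat.add_eq_zero_iff, one_ne_zero, and_false, not_false_eq_true,
      zero_pow, sub_zero, one_div]
    rw [ENNReal.ofReal_inv_of_pos (by positivity), ENNReal.ofReal_add (by positivity) zero_le_one]
    simp
  · exact (continuous_pow N).integrableOn_Icc
  · filter_upwards [ae_restrict_mem measurableSet_Icc] with u hu using pow_nonneg hu.1 N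

/-- If coordinate `0` is maximal and `N` others tie with it, the product is `u ^ N`, with integral
`1 / (N + 1)`; otherwise some factor vanishes. Thus a weight that couples the coordinates becomes a
mixture of products. -/
lemma lintegral_prod_tieWeight {m : ℕ} (p : Fin (m + 1) → ℝ) :
    ∫⁻ u in Set.Icc (0 : ℝ) 1, ∏ i : Fin m, tieWeight u (p 0) (p i.succ) = argmaxProb p := by
  classical
  unfold argmaxProb
  split_ifs with h
  · have h1 : ∀ u, ∏ i : Fin m, tieWeight u (p 0) (p i.succ) =
        ENNReal.ofReal u ^ (Finset.univ.filter fun i : Fin m => p i.succ = p 0).card := by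
      intro u
      rw [← Finset.prod_const, Finset.prod_filter]
      refine Finset.prod_congr rfl fun i _ => ?_
      rcases (h i.succ).lt_or_eq with h2 | h2
      · simp [tieWeight, h2, h2.ne]
      · simp [tieWeight, h2]
    simp_rw [h1]
    rw [lintegral_ofReal_pow, Fin.univ_succ, Finset.filter_cons]
    simp [Finset.filter_map]
  · push Not at h
    obtain ⟨j, hj⟩ := h
    obtain ⟨i, rfl⟩ := Fin.exists_succ_eq.2 (show j ≠ 0 by rintro rfl; exact lt_irrefl _ hj)
    rw [← lintegral_zero (μ := volume.restrict (Set.Icc (0 : ℝ) 1))]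
    congr 1 with u
    exact Finset.prod_eq_zero (Finset.mem_univ i) (by simp [tieWeight, hj.not_gt, hj.ne'])

lemma measurable_argmaxProb {m : ℕ} : Measurable (argmaxProb (m := m)) := by
  have : (argmaxProb (m := m)) = fun p =>
      ∫⁻ u in Set.Icc (0 : ℝ) 1, ∏ i : Fin m, tieWeight u (p 0) (p i.succ) := by
    ext p; exact (lintegral_prod_tieWeight p).symm
  rw [this]
  refine Measurable.lintegral_prod_right' (f := fun z : (Fin (m + 1) → ℝ) × ℝ =>
    ∏ i : Fin m, tieWeight z.2 (z.1 0) (z.1 i.succ)) ?_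
  exact Finset.measurable_prod _ fun i _ => measurable_tieWeight.comp
    (f := fun z : (Fin (m + 1) → ℝ) × ℝ => (z.2, z.1 0, z.1 i.succ)) (by fun_prop)

/-! ### Exchangeability and the law of the numbered means -/

lemma lintegral_pi_prod {m : ℕ} (F : Measure ℝ) [IsProbabilityMeasure F]
    {f : Fin m → ℝ → ℝ≥0∞} (hf : ∀ i, Measurable (f i)) :
    ∫⁻ p, ∏ i, f i (p i) ∂(Measure.pi fun _ : Fin m => F) = ∏ i, ∫⁻ q, f i q ∂F := by
  have h : iIndepFun (fun i (p : Fin m → ℝ) => f i (p i)) (Measure.pi fun _ : Fin m => F) :=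
    iIndepFun_pi fun i => (hf i).aemeasurable
  rw [lintegral_prod_eq_prod_lintegral_of_indepFun Finset.univ _ h
    fun i => (hf i).comp (measurable_pi_apply i)]
  exact Finset.prod_congr rfl fun i _ =>
    (measurePreserving_eval (fun _ : Fin m => F) i).lintegral_comp (hf i)

lemma lintegral_pi_comp_perm {ι : Type*} [Fintype ι] (F : Measure ℝ) [IsProbabilityMeasure F]
    (s : Equiv.Perm ι) (H : (ι → ℝ) → ℝ≥0∞) :
    ∫⁻ p, H (p ∘ s) ∂(Measure.pi fun _ : ι => F) = ∫⁻ p, H p ∂(Measure.pi fun _ : ι => F) :=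
  ((measurePreserving_piCongrLeft (fun _ : ι => F) s).symm).lintegral_comp_emb
    (MeasurableEquiv.measurableEmbedding _) H

/-- Averaging over all orderings of `p` with weights `argmaxProb` is averaging over the orderings
that start with a fixed maximal index. -/
lemma sum_argmaxProb_mul {m : ℕ} (p : Fin (m + 1) → ℝ) (G : (Fin (m + 1) → ℝ) → ℝ≥0∞)
    (a : Fin (m + 1)) (ha : ∀ j, p j ≤ p a) :
    ∑ s : Equiv.Perm (Fin (m + 1)), argmaxProb (p ∘ s) * G (p ∘ s) =
      ∑ s : Equiv.Perm (Fin (m + 1)) with s 0 = a, G (p ∘ s) := by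
  classical
  set N := (Finset.univ.filter fun j => p j = p a).card with hN
  have hN0 : N ≠ 0 := Finset.card_ne_zero_of_mem (a := a) (by simp)
  have h1 : ∀ s : Equiv.Perm (Fin (m + 1)), argmaxProb (p ∘ s) =
      if p (s 0) = p a then (N : ℝ≥0∞)⁻¹ else 0 := by
    intro s
    have h2 : (∀ j, (p ∘ s) j ≤ (p ∘ s) 0) ↔ p (s 0) = p a := by
      constructor
      · intro h
        refine le_antisymm (ha _) ?_
        simpa using h (s.symm a)
      · intro h j
        simpa [h] using ha (s j)
    unfold argmaxProb
    simp only [h2]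
    split_ifs with h
    · congr 2
      rw [hN]
      refine Finset.card_equiv s fun j => ?_
      simp [h]
    · rfl
  -- Swapping two maximal indices leaves `p` unchanged, so the choice among tied arms does not
  -- matter.
  have h3 : ∀ a', p a' = p a → ∑ s : Equiv.Perm (Fin (m + 1)) with s 0 = a', G (p ∘ s) =
      ∑ s : Equiv.Perm (Fin (m + 1)) with s 0 = a, G (p ∘ s) := by
    intro a' h
    have hp : ∀ j, p (Equiv.swap a a' j) = p j := by
      intro j
      rw [Equiv.swap_apply_def]
      split_ifs with h1 h2
      · rw [h1, h]
      · rw [h2, h]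
      · rfl
    refine Finset.sum_equiv (Equiv.mulLeft (Equiv.swap a a')) (fun s => ?_) fun s _ => ?_
    · simp only [Finset.mem_filter, Finset.mem_univ, true_and, Equiv.coe_mulLeft,
        Equiv.Perm.coe_mul, Function.comp_apply]
      rw [Equiv.swap_apply_eq_iff, Equiv.swap_apply_left]
    · congr 1 with j
      simp [hp]
  rw [← Finset.sum_fiberwise Finset.univ (fun s : Equiv.Perm (Fin (m + 1)) => s 0)]
  have h4 : ∀ a', ∑ s : Equiv.Perm (Fin (m + 1)) with s 0 = a', argmaxProb (p ∘ s) * G (p ∘ s) =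
      if p a' = p a then (N : ℝ≥0∞)⁻¹ *
        ∑ s : Equiv.Perm (Fin (m + 1)) with s 0 = a, G (p ∘ s) else 0 := by
    intro a'
    trans ∑ s : Equiv.Perm (Fin (m + 1)) with s 0 = a',
      (if p a' = p a then (N : ℝ≥0∞)⁻¹ else 0) * G (p ∘ s)
    · refine Finset.sum_congr rfl fun s hs => ?_
      rw [h1, (Finset.mem_filter.1 hs).2]
    · rw [← Finset.mul_sum]
      split_ifs with h
      · rw [h3 a' h]
      · simp
  simp_rw [h4]
  rw [← Finset.sum_filter, Finset.sum_const, ← hN, nsmul_eq_mul, ← mul_assoc,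
    ENNReal.mul_inv_cancel (by exact_mod_cast hN0) (ENNReal.natCast_ne_top N), one_mul]

/-- Composing with a swap matches the fibres of `s ↦ s 0`. The value of `C` is never needed, because
it cancels. -/
lemma exists_card_perm_apply_zero_eq (m : ℕ) : ∃ C : ℕ, C ≠ 0 ∧
    (∀ a, (Finset.univ.filter fun s : Equiv.Perm (Fin (m + 1)) => s 0 = a).card = C) ∧
      Fintype.card (Equiv.Perm (Fin (m + 1))) = (m + 1) * C := by
  have h : ∀ a, (Finset.univ.filter fun s : Equiv.Perm (Fin (m + 1)) => s 0 = a).card =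
      (Finset.univ.filter fun s : Equiv.Perm (Fin (m + 1)) => s 0 = 0).card := by
    intro a
    refine Finset.card_equiv (Equiv.mulLeft (Equiv.swap 0 a)) fun s => ?_
    simp only [Finset.mem_filter, Finset.mem_univ, true_and, Equiv.coe_mulLeft,
      Equiv.Perm.coe_mul, Function.comp_apply]
    rw [Equiv.swap_apply_eq_iff, Equiv.swap_apply_left]
  refine ⟨_, Finset.card_ne_zero_of_mem (a := 1) (by simp), h, ?_⟩
  rw [← Finset.card_univ, Finset.card_eq_sum_card_fiberwise
    (f := fun s : Equiv.Perm (Fin (m + 1)) => s 0) (t := Finset.univ) (by simp)]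
  simp_rw [h]
  simp

lemma lintegral_eq_sum_fiber {Ω ι : Type*} [MeasurableSpace Ω] [Fintype ι] (μ : Measure Ω)
    {σ : Ω → ι} (hσ : ∀ s, MeasurableSet {ω | σ ω = s}) {f : ι → Ω → ℝ≥0∞}
    (hf : ∀ s, Measurable (f s)) :
    ∫⁻ ω, f (σ ω) ω ∂μ = ∑ s, ∫⁻ ω in {ω | σ ω = s}, f s ω ∂μ := by
  classical
  simp_rw [← lintegral_indicator (hσ _)]
  rw [← lintegral_finsetSum _ fun s _ => (hf s).indicator (hσ s)]
  congr 1 with ω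
  simp [Set.indicator_apply]

section

variable {Ω : Type*} [MeasurableSpace Ω] {μ : Measure Ω} {m : ℕ}
  {P : Fin (m + 1) → Ω → ℝ} {σ : Ω → Equiv.Perm (Fin (m + 1))}

lemma IsRandomNumbering.setLIntegral_eq (hσ : IsRandomNumbering μ P σ) (hP : ∀ i, Measurable (P i))
    {s s' : Equiv.Perm (Fin (m + 1))} (h : s 0 = s' 0) {H : (Fin (m + 1) → ℝ) → ℝ≥0∞}
    (hH : Measurable H) :
    ∫⁻ ω in {ω | σ ω = s}, H (fun i => P i ω) ∂μ =
      ∫⁻ ω in {ω | σ ω = s'}, H (fun i => P i ω) ∂μ := by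
  have hPm : Measurable fun ω i => P i ω := measurable_pi_lambda _ hP
  rw [← lintegral_map hH hPm, ← lintegral_map hH hPm]
  congr 1
  ext A hA
  rw [Measure.map_apply hPm hA, Measure.map_apply hPm hA, Measure.restrict_apply (hPm hA),
    Measure.restrict_apply (hPm hA), Set.inter_comm, Set.inter_comm _ {ω | σ ω = s'}]
  exact hσ.uniform s s' h A hA

lemma measurable_comp_perm {G : (Fin (m + 1) → ℝ) → ℝ≥0∞} (hG : Measurable G)
    (s : Equiv.Perm (Fin (m + 1))) : Measurable fun p : Fin (m + 1) → ℝ => G (p ∘ s) :=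
  hG.comp (measurable_pi_lambda _ fun i => measurable_pi_apply (s i))

/-- Uniformity makes all numberings with the same first arm interchangeable, so the actual one may
be replaced by the sum over all that share its first arm. This leaves a dependence on `σ` only
through the best arm. -/
lemma IsRandomNumbering.card_mul_lintegral (hσ : IsRandomNumbering μ P σ)
    (hP : ∀ i, Measurable (P i)) {G : (Fin (m + 1) → ℝ) → ℝ≥0∞} (hG : Measurable G) {C : ℕ}
    (hC : ∀ a, (Finset.univ.filter fun s : Equiv.Perm (Fin (m + 1)) => s 0 = a).card = C) :
    (C : ℝ≥0∞) * ∫⁻ ω, G (fun i => P (σ ω i) ω) ∂μ =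
      ∫⁻ ω, ∑ s : Equiv.Perm (Fin (m + 1)) with s 0 = σ ω 0, G ((fun i => P i ω) ∘ s) ∂μ := by
  have hGP : ∀ s : Equiv.Perm (Fin (m + 1)), Measurable fun ω => G ((fun i => P i ω) ∘ s) :=
    fun s => (measurable_comp_perm hG s).comp (measurable_pi_lambda _ hP)
  let K : Fin (m + 1) → Ω → ℝ≥0∞ := fun a ω =>
    ∑ s : Equiv.Perm (Fin (m + 1)) with s 0 = a, G ((fun i => P i ω) ∘ s)
  have hK : ∀ a, Measurable (K a) := fun a => Finset.measurable_sum _ fun s _ => hGP s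
  change _ = ∫⁻ ω, K (σ ω 0) ω ∂μ
  calc (C : ℝ≥0∞) * ∫⁻ ω, G (fun i => P (σ ω i) ω) ∂μ
      = ∑ s : Equiv.Perm (Fin (m + 1)), ∑ s' : Equiv.Perm (Fin (m + 1)) with s' 0 = s 0,
          ∫⁻ ω in {ω | σ ω = s'}, G ((fun i => P i ω) ∘ s) ∂μ := by
        refine (congrArg _ (lintegral_eq_sum_fiber μ hσ.measurable hGP)).trans ?_
        rw [Finset.mul_sum]
        refine Finset.sum_congr rfl fun s _ => ?_
        rw [← hC (s 0), ← nsmul_eq_mul, ← Finset.sum_const]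
        exact Finset.sum_congr rfl fun s' hs' =>
          (hσ.setLIntegral_eq hP (Finset.mem_filter.1 hs').2 (measurable_comp_perm hG s)).symm
    _ = ∑ s' : Equiv.Perm (Fin (m + 1)), ∑ s : Equiv.Perm (Fin (m + 1)) with s 0 = s' 0,
          ∫⁻ ω in {ω | σ ω = s'}, G ((fun i => P i ω) ∘ s) ∂μ :=
        Finset.sum_comm' fun s s' => by simp [eq_comm]
    _ = ∑ s' : Equiv.Perm (Fin (m + 1)), ∫⁻ ω in {ω | σ ω = s'},
          ∑ s : Equiv.Perm (Fin (m + 1)) with s 0 = s' 0, G ((fun i => P i ω) ∘ s) ∂μ :=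
        Finset.sum_congr rfl fun s' _ => (lintegral_finsetSum _ fun s _ => hGP s).symm
    _ = ∑ s' : Equiv.Perm (Fin (m + 1)), ∫⁻ ω in {ω | σ ω = s'}, K (s' 0) ω ∂μ := rfl
    _ = ∫⁻ ω, K (σ ω 0) ω ∂μ := by
        rw [lintegral_eq_sum_fiber μ hσ.measurable (f := fun s' => K (s' 0)) fun s' => hK (s' 0)]

/-- The law of the vector of the arm means listed by number. -/
theorem lintegral_numbered_means [IsProbabilityMeasure μ] {F : Measure ℝ} [IsProbabilityMeasure F]
    (hP : HasPrior μ F P) (hσ : IsRandomNumbering μ P σ) {G : (Fin (m + 1) → ℝ) → ℝ≥0∞}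
    (hG : Measurable G) :
    ∫⁻ ω, G (fun i => P (σ ω i) ω) ∂μ =
      (m + 1) * ∫⁻ p, argmaxProb p * G p ∂(Measure.pi fun _ => F) := by
  have hPm : Measurable fun ω i => P i ω := measurable_pi_lambda _ hP.measurable
  have hlaw : μ.map (fun ω i => P i ω) = Measure.pi fun _ => F := by
    rw [(iIndepFun_iff_map_fun_eq_pi_map fun i => (hP.measurable i).aemeasurable).1 hP.indep]
    simp_rw [hP.law]
  have hKG : Measurable fun p => argmaxProb p * G p := measurable_argmaxProb.mul hG
  obtain ⟨C, hC0, hC, hcard⟩ := exists_card_perm_apply_zero_eq m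
  refine (ENNReal.mul_right_inj (a := (C : ℝ≥0∞)) (by exact_mod_cast hC0)
    (ENNReal.natCast_ne_top C)).1 ?_
  calc (C : ℝ≥0∞) * ∫⁻ ω, G (fun i => P (σ ω i) ω) ∂μ
      = ∫⁻ ω, ∑ s : Equiv.Perm (Fin (m + 1)) with s 0 = σ ω 0, G ((fun i => P i ω) ∘ s) ∂μ :=
        hσ.card_mul_lintegral hP.measurable hG hC
    _ = ∫⁻ ω, ∑ s : Equiv.Perm (Fin (m + 1)),
          argmaxProb ((fun i => P i ω) ∘ s) * G ((fun i => P i ω) ∘ s) ∂μ := by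
        refine lintegral_congr_ae ?_
        filter_upwards [hσ.best] with ω hω
        exact (sum_argmaxProb_mul (fun i => P i ω) G _ hω).symm
    _ = ∑ s : Equiv.Perm (Fin (m + 1)),
          ∫⁻ ω, argmaxProb ((fun i => P i ω) ∘ s) * G ((fun i => P i ω) ∘ s) ∂μ :=
        lintegral_finsetSum _ fun s _ => (measurable_comp_perm hKG s).comp hPm
    _ = ∑ s : Equiv.Perm (Fin (m + 1)),
          ∫⁻ p, argmaxProb (p ∘ s) * G (p ∘ s) ∂(Measure.pi fun _ => F) := by
        rw [← hlaw]
        exact Finset.sum_congr rfl fun s _ =>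
          (lintegral_map (measurable_comp_perm hKG s) hPm).symm
    -- The product measure is invariant under permuting coordinates, so all summands agree.
    _ = ∑ s : Equiv.Perm (Fin (m + 1)),
          ∫⁻ p, argmaxProb p * G p ∂(Measure.pi fun _ => F) :=
        Finset.sum_congr rfl fun s _ =>
          lintegral_pi_comp_perm F s fun p => argmaxProb p * G p
    _ = (C : ℝ≥0∞) * ((m + 1) * ∫⁻ p, argmaxProb p * G p ∂(Measure.pi fun _ => F)) := by
        rw [Finset.sum_const, Finset.card_univ, hcard, nsmul_eq_mul]
        push_cast
        ring

end

/-! ### Probabilities of finite observation sequences -/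

/-- The probability of the sequence of observations `y` from an arm of mean `p`. -/
noncomputable def pathProb {T : ℕ} (p : ℝ) (y : Fin T → Bool) : ℝ≥0∞ :=
  ∏ j, ENNReal.ofReal (if y j = true then p else 1 - p)

lemma measurable_pathProb {T : ℕ} (y : Fin T → Bool) : Measurable fun p => pathProb p y := by
  refine Finset.measurable_prod _ fun j _ => Measurable.ennreal_ofReal ?_
  split_ifs <;> fun_prop

section

variable {Ω : Type*} [MeasurableSpace Ω] {μ : Measure Ω} {n : ℕ}
  {P : Fin n → Ω → ℝ} {σ : Ω → Equiv.Perm (Fin n)} {X : Fin n → ℕ → Ω → Bool}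

lemma sigmaMeans_le (hP : ∀ i, Measurable (P i)) (hσ : ∀ s, MeasurableSet {ω | σ ω = s}) :
    sigmaMeans P σ ≤ (inferInstance : MeasurableSpace Ω) := by
  refine sup_le (iSup_le fun i => (hP i).comap_le) ?_
  rintro _ ⟨B, -, rfl⟩
  have : σ ⁻¹' B = ⋃ s ∈ B, {ω | σ ω = s} := by ext ω; simp
  rw [this]
  exact MeasurableSet.biUnion B.to_countable fun s _ => hσ s

/-- The event `σ = s` belongs to `sigmaMeans P σ`, so the conditional probability of a path may be
integrated over it; there the numbers translate into fixed arms. -/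
lemma HasBernoulliRewards.measure_path_eq [IsProbabilityMeasure μ]
    (hX : HasBernoulliRewards μ P σ X) (hP : ∀ i, Measurable (P i))
    (hP01 : ∀ᵐ ω ∂μ, ∀ i, P i ω ∈ Set.Icc (0 : ℝ) 1) (hσ : ∀ s, MeasurableSet {ω | σ ω = s})
    (s : Equiv.Perm (Fin n)) {T : ℕ} (y : Fin n → Fin T → Bool) :
    μ ({ω | (fun i (j : Fin T) => X (s i) j ω) = y} ∩ {ω | σ ω = s}) =
      ∫⁻ ω in {ω | σ ω = s}, ∏ i, pathProb (P (s i) ω) (y i) ∂μ := by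
  have hle := sigmaMeans_le hP hσ
  set S : Finset (Fin n × ℕ) := Finset.univ ×ˢ Finset.range T
  -- `y` is indexed by number and `x` by arm, hence `s.symm`; the value `false` beyond `T` is never
  -- read, since `S` stops before `T`.
  set x : Fin n × ℕ → Bool := fun q => if h : q.2 < T then y (s.symm q.1) ⟨q.2, h⟩ else false
  have hE : {ω | (fun i (j : Fin T) => X (s i) j ω) = y} = {ω | ∀ q ∈ S, X q.1 q.2 ω = x q} := by
    ext ω
    simp only [Set.mem_ofPred_eq, funext_iff, Prod.forall, S, x, Finset.mem_product,
      Finset.mem_univ, true_and, Finset.mem_range]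
    constructor
    · intro h i j hj
      simpa [hj] using h (s.symm i) ⟨j, hj⟩
    · intro h i j
      simpa using h (s i) j j.2
  have hprod : ∀ ω, (∏ q ∈ S, if x q = true then P q.1 ω else 1 - P q.1 ω) =
      ∏ i, ∏ j, if y i j = true then P (s i) ω else 1 - P (s i) ω := by
    intro ω
    rw [Finset.prod_product, ← Equiv.prod_comp s]
    refine Finset.prod_congr rfl fun i _ => ?_
    rw [Finset.prod_range]
    refine Finset.prod_congr rfl fun j _ => ?_
    simp [x]
  rw [hE]
  set E := {ω | ∀ q ∈ S, X q.1 q.2 ω = x q} with hEdef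
  have hEm : MeasurableSet E := by
    have : E = ⋂ q ∈ S, X q.1 q.2 ⁻¹' {x q} := by ext ω; simp [hEdef]
    rw [this]
    exact MeasurableSet.biInter S.countable_toSet fun q _ =>
      hX.measurable q.1 q.2 (measurableSet_singleton _)
  have hfib : MeasurableSet[sigmaMeans P σ] {ω | σ ω = s} :=
    (le_sup_right : MeasurableSpace.comap σ ⊤ ≤ sigmaMeans P σ) _ ⟨{s}, trivial, rfl⟩
  have hcond := hX.cond S x
  have hint := integrable_condExp.congr hcond
  have hreal : μ.real (E ∩ {ω | σ ω = s}) =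
      ∫ ω in {ω | σ ω = s}, ∏ q ∈ S, (if x q = true then P q.1 ω else 1 - P q.1 ω) ∂μ := by
    rw [← setIntegral_congr_ae (hσ s) (hcond.mono fun ω h _ => h), setIntegral_condExp hle
      ((integrable_const (1 : ℝ)).indicator hEm) hfib, integral_indicator hEm,
      Measure.restrict_restrict hEm]
    simp
  rw [← ofReal_measureReal, hreal, ofReal_integral_eq_lintegral_ofReal hint.integrableOn]
  · refine lintegral_congr_ae (ae_restrict_of_ae ?_)
    filter_upwards [hP01] with ω hω
    have h0 : ∀ i j, 0 ≤ if y i j = true then P (s i) ω else 1 - P (s i) ω := by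
      intro i j
      have := hω (s i)
      split_ifs
      · exact this.1
      · linarith [this.2]
    rw [hprod, ENNReal.ofReal_prod_of_nonneg fun i _ => Finset.prod_nonneg fun j _ => h0 i j]
    exact Finset.prod_congr rfl fun i _ => ENNReal.ofReal_prod_of_nonneg fun j _ => h0 i j
  · refine ae_restrict_of_ae ?_
    filter_upwards [hP01] with ω hω
    refine Finset.prod_nonneg fun q _ => ?_
    have := hω q.1
    split_ifs
    · exact this.1
    · linarith [this.2]

lemma HasBernoulliRewards.measure_numbered_paths [IsProbabilityMeasure μ]
    (hX : HasBernoulliRewards μ P σ X) (hP : ∀ i, Measurable (P i))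
    (hP01 : ∀ᵐ ω ∂μ, ∀ i, P i ω ∈ Set.Icc (0 : ℝ) 1) (hσ : ∀ s, MeasurableSet {ω | σ ω = s})
    {T : ℕ} (A : Set (Fin n → Fin T → Bool)) :
    μ {ω | (fun i (j : Fin T) => X (σ ω i) j ω) ∈ A} =
      ∫⁻ ω, ∑ y, A.indicator (fun y => ∏ i, pathProb (P (σ ω i) ω) (y i)) y ∂μ := by
  have hXm : ∀ s : Equiv.Perm (Fin n), Measurable fun ω i (j : Fin T) => X (s i) j ω := fun s =>
    measurable_pi_lambda _ fun i => measurable_pi_lambda _ fun j => hX.measurable (s i) j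
  have hm : ∀ (s : Equiv.Perm (Fin n)) (y : Fin n → Fin T → Bool), Measurable fun ω =>
      A.indicator (fun y => ∏ i, pathProb (P (s i) ω) (y i)) y := by
    intro s y
    by_cases hy : y ∈ A
    · simp only [Set.indicator_of_mem hy]
      exact Finset.measurable_prod _ fun i _ => (measurable_pathProb (y i)).comp (hP (s i))
    · simp only [Set.indicator_of_notMem hy]
      exact measurable_const
  let K : Equiv.Perm (Fin n) → Ω → ℝ≥0∞ := fun s ω =>
    ∑ y, A.indicator (fun y => ∏ i, pathProb (P (s i) ω) (y i)) y
  have hK : ∀ s, Measurable (K s) := fun s => Finset.measurable_sum _ fun y _ => hm s y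
  change _ = ∫⁻ ω, K (σ ω) ω ∂μ
  have hset : {ω | (fun i (j : Fin T) => X (σ ω i) j ω) ∈ A} =
      ⋃ s, {ω | (fun i (j : Fin T) => X (s i) j ω) ∈ A} ∩ {ω | σ ω = s} := by
    ext ω; simp
  rw [lintegral_eq_sum_fiber μ hσ hK, hset, measure_iUnion, tsum_fintype]
  · refine Finset.sum_congr rfl fun s _ => ?_
    have hset' : {ω | (fun i (j : Fin T) => X (s i) j ω) ∈ A} ∩ {ω | σ ω = s} =
        ⋃ y ∈ A, ({ω | (fun i (j : Fin T) => X (s i) j ω) = y} ∩ {ω | σ ω = s}) := by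
      ext ω; simp
    rw [hset', measure_biUnion A.to_countable, tsum_subtype A fun y =>
      μ ({ω | (fun i (j : Fin T) => X (s i) j ω) = y} ∩ {ω | σ ω = s}), tsum_fintype,
      lintegral_finsetSum _ fun y _ => hm s y]
    · refine Finset.sum_congr rfl fun y _ => ?_
      by_cases hy : y ∈ A
      · simp only [Set.indicator_of_mem hy]
        exact hX.measure_path_eq hP hP01 hσ s y
      · simp [Set.indicator_of_notMem hy]
    · intro y _ y' _ hne
      refine Set.disjoint_left.2 fun ω h h' => hne ?_
      exact h.1.symm.trans h'.1
    · exact fun y _ => (hXm s (measurableSet_singleton y)).inter (hσ s)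
  · intro s s' hne
    refine Set.disjoint_left.2 fun ω h h' => hne ?_
    exact h.2.symm.trans h'.2
  · exact fun s => (hXm s (Set.toFinite A).measurableSet).inter (hσ s)

end

/-- The probability that an arm of mean `q` produces a sequence of observations in `S`. -/
noncomputable def pathMeasure {T : ℕ} (q : ℝ) (S : Set (Fin T → Bool)) : ℝ≥0∞ :=
  ∑ z, S.indicator (pathProb q) z

lemma measurable_pathMeasure {T : ℕ} (S : Set (Fin T → Bool)) :
    Measurable fun q => pathMeasure q S := by
  refine Finset.measurable_sum _ fun z _ => ?_
  by_cases hz : z ∈ S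
  · simp only [Set.indicator_of_mem hz]
    exact measurable_pathProb z
  · simp only [Set.indicator_of_notMem hz]
    exact measurable_const

lemma sum_indicator_prod_pathProb {T m : ℕ} (R : Fin m → (Fin T → Bool) → Set (Fin T → Bool))
    (q : Fin (m + 1) → ℝ) :
    ∑ y, {y : Fin (m + 1) → Fin T → Bool | ∀ i, y i.succ ∈ R i (y 0)}.indicator
        (fun y => ∏ i, pathProb (q i) (y i)) y =
      ∑ x, pathProb (q 0) x * ∏ i : Fin m, pathMeasure (q i.succ) (R i x) := by
  classical
  rw [← (Fin.consEquiv fun _ => Fin T → Bool).sum_comp, Fintype.sum_prod_type]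
  refine Finset.sum_congr rfl fun x _ => ?_
  simp only [pathMeasure]
  rw [Finset.prod_univ_sum, Fintype.piFinset_univ, Finset.mul_sum]
  refine Finset.sum_congr rfl fun z _ => ?_
  by_cases hz : ∀ i, z i ∈ R i x
  · rw [Set.indicator_of_mem (by simpa [Fin.consEquiv] using hz)]
    rw [Fin.prod_univ_succ]
    simp [Fin.consEquiv, Set.indicator_of_mem (hz _)]
  · rw [Set.indicator_of_notMem (by simpa [Fin.consEquiv] using hz)]
    push Not at hz
    obtain ⟨i, hi⟩ := hz
    rw [Finset.prod_eq_zero (Finset.mem_univ i) (Set.indicator_of_notMem hi _), mul_zero]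

/-! ### Conditional independence of the losing arms -/

/-- The probability that an arm with mean drawn from `F` loses the maximum against mean `a`, ties
being weighted by `u`, and produces a sequence of observations in `S`. -/
noncomputable def loserMeasure {T : ℕ} (F : Measure ℝ) (u a : ℝ) (S : Set (Fin T → Bool)) :
    ℝ≥0∞ :=
  ∫⁻ q, tieWeight u a q * pathMeasure q S ∂F

lemma lintegral_pi_cons {m : ℕ} (F : Measure ℝ) [IsProbabilityMeasure F]
    {K : (Fin (m + 1) → ℝ) → ℝ≥0∞} (hK : Measurable K) :
    ∫⁻ p, K p ∂(Measure.pi fun _ => F) =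
      ∫⁻ a, ∫⁻ r, K (Fin.cons a r) ∂(Measure.pi fun _ : Fin m => F) ∂F := by
  rw [← ((measurePreserving_piFinSuccAbove (fun _ : Fin (m + 1) => F) 0).symm).lintegral_comp hK,
    lintegral_prod]
  · simp [MeasurableEquiv.piFinSuccAbove, Fin.insertNthEquiv]
  · exact (hK.comp (MeasurableEquiv.measurable _)).aemeasurable

/-- Expand `argmaxProb` as an integral over `u` and move that integral outside by Tonelli. With `u`,
the best mean and its path fixed, the integrand is a product over the remaining coordinates, so the
integral factors. -/
lemma lintegral_argmaxProb_mul {T m : ℕ} (F : Measure ℝ) [IsProbabilityMeasure F]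
    (R : Fin m → (Fin T → Bool) → Set (Fin T → Bool)) :
    ∫⁻ p, argmaxProb p * ∑ x, pathProb (p 0) x * ∏ i : Fin m, pathMeasure (p i.succ) (R i x)
        ∂(Measure.pi fun _ => F) =
      ∫⁻ u in Set.Icc (0 : ℝ) 1, ∫⁻ a,
        ∑ x, pathProb a x * ∏ i : Fin m, loserMeasure F u a (R i x) ∂F := by
  have hG : Measurable fun p : Fin (m + 1) → ℝ =>
      ∑ x, pathProb (p 0) x * ∏ i : Fin m, pathMeasure (p i.succ) (R i x) :=
    Finset.measurable_sum _ fun x _ => ((measurable_pathProb x).comp (measurable_pi_apply 0)).mul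
      (Finset.measurable_prod _ fun i _ =>
        (measurable_pathMeasure (R i x)).comp (measurable_pi_apply i.succ))
  have hW : Measurable fun z : (Fin (m + 1) → ℝ) × ℝ =>
      ∏ i : Fin m, tieWeight z.2 (z.1 0) (z.1 i.succ) :=
    Finset.measurable_prod _ fun i _ => measurable_tieWeight.comp
      (f := fun z : (Fin (m + 1) → ℝ) × ℝ => (z.2, z.1 0, z.1 i.succ)) (by fun_prop)
  have hw : ∀ u a, Measurable (tieWeight u a) := fun u a =>
    measurable_tieWeight.comp (f := fun q : ℝ => (u, a, q)) (by fun_prop)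
  have h0 : ∀ p : Fin (m + 1) → ℝ,
      argmaxProb p * ∑ x, pathProb (p 0) x * ∏ i : Fin m, pathMeasure (p i.succ) (R i x) =
        ∫⁻ u in Set.Icc (0 : ℝ) 1, (∏ i : Fin m, tieWeight u (p 0) (p i.succ)) *
          ∑ x, pathProb (p 0) x * ∏ i : Fin m, pathMeasure (p i.succ) (R i x) := by
    intro p
    rw [← lintegral_prod_tieWeight]
    exact (lintegral_mul_const _ (hW.comp (measurable_prodMk_left (x := p)))).symm
  simp_rw [h0]
  rw [lintegral_lintegral_swap (hW.mul (hG.comp measurable_fst)).aemeasurable]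
  refine lintegral_congr fun u => ?_
  refine (lintegral_pi_cons F ((hW.comp (measurable_prodMk_right (y := u))).mul hG)).trans ?_
  refine lintegral_congr fun a => ?_
  simp only [Pi.mul_apply, Function.comp_apply, Fin.cons_zero, Fin.cons_succ]
  have h1 : ∀ r : Fin m → ℝ, (∏ i, tieWeight u a (r i)) *
      ∑ x, pathProb a x * ∏ i, pathMeasure (r i) (R i x) =
      ∑ x, pathProb a x * ∏ i, tieWeight u a (r i) * pathMeasure (r i) (R i x) := by
    intro r
    rw [Finset.mul_sum]
    refine Finset.sum_congr rfl fun x _ => ?_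
    rw [Finset.prod_mul_distrib]
    ring
  simp_rw [h1]
  have hf : ∀ x i, Measurable fun q => tieWeight u a q * pathMeasure q (R i x) :=
    fun x i => (hw u a).mul (measurable_pathMeasure _)
  have hfp : ∀ x, Measurable fun r : Fin m → ℝ =>
      ∏ i, tieWeight u a (r i) * pathMeasure (r i) (R i x) := fun x =>
    Finset.measurable_prod _ fun i _ => (hf x i).comp (measurable_pi_apply i)
  rw [lintegral_finsetSum _ fun x _ => (hfp x).const_mul _]
  refine Finset.sum_congr rfl fun x _ => ?_
  rw [lintegral_const_mul _ (hfp x), lintegral_pi_prod F (hf x)]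
  rfl

/-- Given the best arm, its mean and its observations, the other arms are conditionally
independent once ties are weighted by `u`. -/
theorem measure_paths_eq {Ω : Type*} [MeasurableSpace Ω] {μ : Measure Ω} [IsProbabilityMeasure μ]
    {m : ℕ} {F : Measure ℝ} [IsProbabilityMeasure F] (hF : ∀ᵐ p ∂F, p ∈ Set.Icc (0 : ℝ) 1)
    {P : Fin (m + 1) → Ω → ℝ} (hP : HasPrior μ F P) {σ : Ω → Equiv.Perm (Fin (m + 1))}
    (hσ : IsRandomNumbering μ P σ) {X : Fin (m + 1) → ℕ → Ω → Bool}
    (hX : HasBernoulliRewards μ P σ X) {T : ℕ}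
    (R : Fin m → (Fin T → Bool) → Set (Fin T → Bool)) :
    μ {ω | ∀ i : Fin m, (fun j : Fin T => X (σ ω i.succ) j ω) ∈
        R i fun j : Fin T => X (σ ω 0) j ω} =
      (m + 1) * ∫⁻ u in Set.Icc (0 : ℝ) 1, ∫⁻ a,
        ∑ x, pathProb a x * ∏ i : Fin m, loserMeasure F u a (R i x) ∂F := by
  have hP01 : ∀ᵐ ω ∂μ, ∀ i, P i ω ∈ Set.Icc (0 : ℝ) 1 := by
    rw [ae_all_iff]
    intro i
    rw [← hP.law i] at hF
    exact ae_of_ae_map (hP.measurable i).aemeasurable hF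
  have hG : Measurable fun p : Fin (m + 1) → ℝ =>
      ∑ x, pathProb (p 0) x * ∏ i : Fin m, pathMeasure (p i.succ) (R i x) :=
    Finset.measurable_sum _ fun x _ => ((measurable_pathProb x).comp (measurable_pi_apply 0)).mul
      (Finset.measurable_prod _ fun i _ =>
        (measurable_pathMeasure (R i x)).comp (measurable_pi_apply i.succ))
  rw [← lintegral_argmaxProb_mul, ← lintegral_numbered_means hP hσ hG]
  refine (hX.measure_numbered_paths hP.measurable hP01 hσ.measurable
    {y | ∀ i : Fin m, y i.succ ∈ R i (y 0)}).trans ?_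
  exact lintegral_congr fun ω => sum_indicator_prod_pathProb R fun i => P (σ ω i) ω

lemma measurable_loserMeasure {T : ℕ} (F : Measure ℝ) [IsProbabilityMeasure F]
    (S : Set (Fin T → Bool)) : Measurable fun z : ℝ × ℝ => loserMeasure F z.1 z.2 S := by
  refine Measurable.lintegral_prod_right' (f := fun w : (ℝ × ℝ) × ℝ =>
    tieWeight w.1.1 w.1.2 w.2 * pathMeasure w.2 S) ?_
  exact (measurable_tieWeight.comp (f := fun w : (ℝ × ℝ) × ℝ => (w.1.1, w.1.2, w.2))
    (by fun_prop)).mul ((measurable_pathMeasure S).comp measurable_snd)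

/-! ### Positive correlation for games of finite length -/

section

variable {Ω : Type*} [MeasurableSpace Ω] {μ : Measure Ω} [IsProbabilityMeasure μ]
    {m : ℕ} {F : Measure ℝ} [IsProbabilityMeasure F]

/-- If all other arms play the same game, decided by finitely many observations, against the best
arm, then the results of these games are positively correlated. -/
theorem pow_measure_path_le {P : Fin (m + 2) → Ω → ℝ} {σ : Ω → Equiv.Perm (Fin (m + 2))}
    {X : Fin (m + 2) → ℕ → Ω → Bool} (hF : ∀ᵐ p ∂F, p ∈ Set.Icc (0 : ℝ) 1)
    (hP : HasPrior μ F P) (hσ : IsRandomNumbering μ P σ)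
    (hX : HasBernoulliRewards μ P σ X) {T : ℕ} (S : (Fin T → Bool) → Set (Fin T → Bool)) :
    μ {ω | (fun j : Fin T => X (σ ω 1) j ω) ∈ S fun j : Fin T => X (σ ω 0) j ω} ^ (m + 1) ≤
      μ {ω | ∀ i : Fin (m + 1), (fun j : Fin T => X (σ ω i.succ) j ω) ∈
        S fun j : Fin T => X (σ ω 0) j ω} := by
  set ν : Measure (ℝ × ℝ) := (volume.restrict (Set.Icc (0 : ℝ) 1)).prod F
  set h : ℝ × ℝ → (Fin T → Bool) → ℝ≥0∞ := fun z x => loserMeasure F z.1 z.2 (S x) with hh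
  set W : ℝ × ℝ → ℝ≥0∞ := fun z =>
    loserMeasure F z.1 z.2 (Set.univ : Set (Fin T → Bool)) with hW
  have hhm : ∀ x, Measurable fun z => h z x := fun x => measurable_loserMeasure F (S x)
  have hWm : Measurable W := measurable_loserMeasure F _
  have hbm : ∀ x : Fin T → Bool, Measurable fun z : ℝ × ℝ => pathProb z.2 x := fun x =>
    (measurable_pathProb x).comp measurable_snd
  -- Used with three constraints: `S` for every arm, none at all, and `S` for the first other arm
  -- only. They express `P(B)`, `1` and `P(B_1)` by the same kind of integral.
  have key : ∀ R : Fin (m + 1) → (Fin T → Bool) → Set (Fin T → Bool),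
      μ {ω | ∀ i : Fin (m + 1), (fun j : Fin T => X (σ ω i.succ) j ω) ∈
          R i fun j : Fin T => X (σ ω 0) j ω} =
        ((m + 1 : ℕ) + 1) * ∫⁻ z, ∑ x, pathProb z.2 x *
          ∏ i : Fin (m + 1), loserMeasure F z.1 z.2 (R i x) ∂ν := by
    intro R
    rw [measure_paths_eq hF hP hσ hX R, lintegral_prod]
    exact (Finset.measurable_sum _ fun x _ => (hbm x).mul (Finset.measurable_prod _ fun i _ =>
      measurable_loserMeasure F (R i x))).aemeasurable
  have hB := key fun _ => S
  have hone := key fun _ _ => Set.univ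
  have hB1 := key fun i x => if i = 0 then S x else Set.univ
  have hset : {ω | ∀ i : Fin (m + 1), (fun j : Fin T => X (σ ω i.succ) j ω) ∈
      if i = 0 then S fun j : Fin T => X (σ ω 0) j ω else Set.univ} =
      {ω | (fun j : Fin T => X (σ ω 1) j ω) ∈ S fun j : Fin T => X (σ ω 0) j ω} := by
    ext ω
    simp only [Set.mem_ofPred_eq, Fin.forall_fin_succ]
    simp
  rw [hset] at hB1
  simp only [Fin.prod_univ_succ (n := m), if_true, Fin.succ_ne_zero, if_false,
    Finset.prod_const, Finset.card_univ, Fintype.card_fin, ← pow_succ'] at hB1 hB hone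
  simp only [Set.mem_univ, implies_true, Set.ofPred_true, measure_univ] at hone
  change _ = _ * ∫⁻ z, ∑ x, pathProb z.2 x * h z x ^ (m + 1) ∂ν at hB
  change _ = _ * ∫⁻ z, ∑ x, pathProb z.2 x * (h z x * W z ^ m) ∂ν at hB1
  change _ = _ * ∫⁻ z, ∑ x : Fin T → Bool, pathProb z.2 x * W z ^ (m + 1) ∂ν at hone
  set c := μ {ω | (fun j : Fin T => X (σ ω 1) j ω) ∈ S fun j : Fin T => X (σ ω 0) j ω} with hc
  have hctop : c ≠ ⊤ := measure_ne_top μ _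
  -- AM-GM is applied pointwise to `h` and `c * W`; scaling by `c = P(B_1)` is what makes the
  -- integrated bound give exactly `c ^ (m + 1)`.
  have hyoung : (m + 1) * c ^ m * ∫⁻ z, ∑ x, pathProb z.2 x * (h z x * W z ^ m) ∂ν ≤
      ∫⁻ z, ∑ x, pathProb z.2 x * h z x ^ (m + 1) ∂ν +
        m * c ^ (m + 1) * ∫⁻ z, ∑ x : Fin T → Bool, pathProb z.2 x * W z ^ (m + 1) ∂ν := by
    rw [← lintegral_const_mul, ← lintegral_const_mul, ← lintegral_add_left]
    · refine lintegral_mono fun z => ?_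
      rw [Finset.mul_sum, Finset.mul_sum, ← Finset.sum_add_distrib]
      refine Finset.sum_le_sum fun x _ => ?_
      calc (m + 1) * c ^ m * (pathProb z.2 x * (h z x * W z ^ m))
          = pathProb z.2 x * ((m + 1) * (h z x * (c * W z) ^ m)) := by ring
        _ ≤ pathProb z.2 x * (h z x ^ (m + 1) + m * (c * W z) ^ (m + 1)) := by
          gcongr
          exact mul_mul_pow_le_pow_add _ _ m
        _ = _ := by ring
    · exact Finset.measurable_sum _ fun x _ => (hbm x).mul ((hhm x).pow_const _)
    · exact Finset.measurable_sum _ fun x _ => (hbm x).mul (hWm.pow_const _)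
    · exact Finset.measurable_sum _ fun x _ => (hbm x).mul ((hhm x).mul (hWm.pow_const _))
  rw [hB]
  -- After multiplication by the number of arms this reads `(m + 1) * c ^ (m + 1) ≤ P(B) + m * c ^
  -- (m + 1)`, and the finite term `m * c ^ (m + 1)` cancels.
  have h1 := mul_le_mul_right hyoung ((m + 1 : ℕ) + 1 : ℝ≥0∞)
  rw [mul_add, mul_left_comm, ← hB1, mul_left_comm, ← hone, mul_one, mul_assoc, ← pow_succ,
    add_mul, one_mul, add_comm] at h1
  refine (ENNReal.add_le_add_iff_right (a := m * c ^ (m + 1)) ?_).1 h1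
  exact ENNReal.mul_ne_top (ENNReal.natCast_ne_top m) (ENNReal.pow_ne_top hctop)

end

/-! ### Truncated gambler's ruin and the limit -/

/-- Arm `a` wins its gambler's ruin game against arm `b` within `T` rounds. -/
def BeatsWithin {Ω : Type*} {n : ℕ} (X : Fin n → ℕ → Ω → Bool) (k T : ℕ) (a b : Fin n) (ω : Ω) :
    Prop :=
  ∃ t ≤ T, (successes X a t ω : ℤ) - successes X b t ω = k ∧
    ∀ r < t, (successes X a r ω : ℤ) - successes X b r ω ≠ -k

/-- The number of successes among the first `t` entries of `x`. -/
def countTrue {T : ℕ} (x : Fin T → Bool) (t : ℕ) : ℕ :=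
  (Finset.univ.filter fun j : Fin T => (j : ℕ) < t ∧ x j = true).card

/-- The sequences of observations against which `x` wins its gambler's ruin game. -/
def beatenBy {T : ℕ} (k : ℕ) (x : Fin T → Bool) : Set (Fin T → Bool) :=
  {z | ∃ t ≤ T, (countTrue x t : ℤ) - countTrue z t = k ∧
    ∀ r < t, (countTrue x r : ℤ) - countTrue z r ≠ -k}

lemma countTrue_eq_successes {Ω : Type*} {n : ℕ} (X : Fin n → ℕ → Ω → Bool) (a : Fin n) (ω : Ω)
    {t T : ℕ} (h : t ≤ T) : countTrue (fun j : Fin T => X a j ω) t = successes X a t ω := by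
  refine Finset.card_bij (fun j _ => (j : ℕ)) (fun j hj => by simpa using hj)
    (fun i _ j _ hij => Fin.ext hij) fun j hj => ?_
  simp only [Finset.mem_filter, Finset.mem_range] at hj
  exact ⟨⟨j, hj.1.trans_le h⟩, by simpa using hj, rfl⟩

lemma mem_beatenBy_iff {Ω : Type*} {n : ℕ} (X : Fin n → ℕ → Ω → Bool) (k T : ℕ) (a b : Fin n)
    (ω : Ω) : (fun j : Fin T => X b j ω) ∈ beatenBy k (fun j : Fin T => X a j ω) ↔
      BeatsWithin X k T a b ω := by
  refine exists_congr fun t => and_congr_right fun ht => ?_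
  rw [countTrue_eq_successes X a ω ht, countTrue_eq_successes X b ω ht]
  refine and_congr_right fun _ => forall₂_congr fun r hr => ?_
  rw [countTrue_eq_successes X a ω (hr.le.trans ht), countTrue_eq_successes X b ω (hr.le.trans ht)]

end BernoulliArms

open BernoulliArms in
theorem mainTheorem2 {Ω : Type*} [MeasurableSpace Ω] (μ : Measure Ω) [IsProbabilityMeasure μ]
    (n : ℕ) [NeZero n] (hn : 2 ≤ n) (k : ℕ) (hk : 1 ≤ k)
    (F : Measure ℝ) [IsProbabilityMeasure F] (hF : ∀ᵐ p ∂F, p ∈ Set.Icc (0 : ℝ) 1)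
    (P : Fin n → Ω → ℝ) (hP : BernoulliArms.HasPrior μ F P)
    (σ : Ω → Equiv.Perm (Fin n)) (hσ : BernoulliArms.IsRandomNumbering μ P σ)
    (X : Fin n → ℕ → Ω → Bool) (hX : BernoulliArms.HasBernoulliRewards μ P σ X) :
    μ (⋂ (i : Fin n) (_ : i ≠ 0), BernoulliArms.bestBeats X k σ i) ≥
      μ (BernoulliArms.bestBeats X k σ ⟨1, hn⟩) ^ (n - 1) := by
  obtain ⟨m, rfl⟩ : ∃ m, n = m + 2 := ⟨n - 2, by omega⟩
  have hunion : bestBeats X k σ ⟨1, hn⟩ = ⋃ T, {ω | BeatsWithin X k T (σ ω 0) (σ ω 1) ω} := by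
    ext ω
    simp only [Set.mem_iUnion]
    exact ⟨fun ⟨t, ht⟩ => ⟨t, t, le_rfl, ht⟩, fun ⟨_, t, _, ht⟩ => ⟨t, ht⟩⟩
  have hmono : Monotone fun T => {ω | BeatsWithin X k T (σ ω 0) (σ ω 1) ω} :=
    fun T T' h ω ⟨t, ht, h'⟩ => ⟨t, ht.trans h, h'⟩
  have hlim := ((ENNReal.continuous_pow (m + 1)).tendsto _).comp
    (tendsto_measure_iUnion_atTop (μ := μ) hmono)
  rw [← hunion] at hlim
  -- Only `P(B_1)` needs a limit: winning all games within `T` rounds already implies `B`.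
  refine le_of_tendsto' hlim fun T => ?_
  have h := pow_measure_path_le hF hP hσ hX (T := T) (beatenBy k)
  simp only [mem_beatenBy_iff] at h
  refine h.trans (measure_mono fun ω hω => ?_)
  simp only [Set.mem_iInter]
  intro i hi
  obtain ⟨i, rfl⟩ := Fin.exists_succ_eq.2 hi
  obtain ⟨t, -, ht⟩ := hω i
  exact ⟨t, ht⟩
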